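/- **Setting.** Let $(\bar M,\bar g,\bar J)$ be an indefinite Kähler manifold of real dimension $2k$: $\bar g$ is a semi-Riemannian metric of constant index $q$, $0<q<2k$, $\bar J^2=-I$, $\bar g(\bar JX,\bar JY)=\bar g(X,Y)$, and $\bar J$ is parallel for the Levi-Civita connection of $\bar g$. Let $M$ be an (immersed) $m$-dimensional lightlike submanifold: $Rad(TM)=TM\cap TM^\perp$ is a smooth distribution of constant rank $r$, $1\le r\le m$. A choice of *screen bundles* for $M$ consists of non-degenerate bundles $S(TM)$, $S(TM^\perp)$ with $TM=S(TM)\perp Rad(TM)$ and $TM^\perp=S(TM^\perp)\perp Rad(TM)$, and a lightlike transversal bundle $ltr(TM)$, i.e. a complement of $Rad(TM)$ in $S(TM)^\perp\cap S(TM^\perp)^\perp$ which locally has frames $N_i$ with $\bar g(\xi_i,N_j)=\delta_{ij}$, $\bar g(N_i,N_j)=0$ for a local frame $\xi_i$ of $Rad(TM)$. "$\perp$" between bundles denotes an orthogonal direct sum; all bundles are smooth of constant rank and may be zero. * $M$ with given screen bundles is *STCR lightlike* if there are subbundles $D_1,D_2$ of $Rad(TM)$ and $D_0,D'$ of $S(TM)$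 with $$Rad(TM)=D_1\oplus D_2,\quad \bar JD_1\subset S(TM),\quad \bar JD_2\subset S(TM^\perp),$$ $$S(TM)=\{\bar JD_1\oplus D'\}\perp D_0,\quad \bar JD_0=D_0,\quad \bar JD'=L_1\perp S,$$ where $D_0$ is non-degenerate and $L_1\subset ltr(TM)$, $S\subset S(TM^\perp)$ are subbundles. * $M$ with given screen bundles is *CR-lightlike* if $\bar J Rad(TM)$ is a distribution on $M$ with $Rad(TM)\cap\bar JRad(TM)=\{0\}$ and there are subbundles $D_0,D'$ of $S(TM)$ with $S(TM)=\{\bar JRad(TM)\oplus D'\}\perp D_0$, $\bar JD_0=D_0$, $\bar JD'=L_1\perp L_2$, where $D_0$ is non-degenerate and $L_1\subset ltr(TM)$, $L_2\subset S(TM^\perp)$ are subbundles. $M$ is CR-lightlike if this holds for some choice of screen bundles. * $M$ is *screen transversal lightlike* with respect to $S(TM^\perp)$ if $\bar JRad(TM)\subset S(TM^\perp)$; it is screen transversal lightlike if this holds for some choice of $S(TM^\perp)$. **Proposition 3.1.** Let $M$ be an STCR lightlike submanifold of $\bar M$ with given screen bundles and with bundles $D_1,D_2,D_0,D',L_1,S$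 as above. Then 1. $M$ is a CR-lightlike submanifold if and only if $D_2=\{0\}$; 2. $M$ is a screen transversal lightlike submanifold if and only if $D_1=\{0\}$. In both equivalences it does not matter whether "CR-lightlike" and "screen transversal lightlike" are meant for the given screen bundles or for some choice of screen bundles. Moreover, if a lightlike submanifold $M$ of $\bar M$ is CR-lightlike for some screen bundles, then it is STCR lightlike for the same screen bundles. If $M$ is screen transversal lightlike for given screen bundles, then it is STCR lightlike for these screen bundles if and only if $S(TM)=D'\perp D_0$ for some subbundles $D_0,D'$ with $D_0$ non-degenerate, $\bar JD_0=D_0$ and $\bar JD'\subset S(TM^\perp)$. -/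

import Mathlib

open scoped Manifold ContDiff Topology
open Bundle

namespace LightlikeGeometry

section Ambient

/-- A semi-Riemannian metric of constant index `q` on an `n`-manifold: a smooth field of
symmetric non-degenerate bilinear forms, each of index `q` (the index is the maximal dimension of
a subspace on which the form is negative definite). -/
structure IsSemiRiemannianMetric (n q : ℕ) {N : Type*} [TopologicalSpace N]
    [ChartedSpace (EuclideanSpace ℝ (Fin n)) N] [IsManifold (𝓡 n) ∞ N]
    (g : ∀ p : N, TangentSpace (𝓡 n) p →L[ℝ] TangentSpace (𝓡 n) p →L[ℝ] ℝ) : Prop where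
  smooth : ContMDiff (𝓡 n)
    ((𝓡 n).prod 𝓘(ℝ, EuclideanSpace ℝ (Fin n) →L[ℝ] EuclideanSpace ℝ (Fin n) →L[ℝ] ℝ)) ∞
    (fun p ↦ TotalSpace.mk' (EuclideanSpace ℝ (Fin n) →L[ℝ] EuclideanSpace ℝ (Fin n) →L[ℝ] ℝ)
      (E := fun p : N ↦ TangentSpace (𝓡 n) p →L[ℝ] TangentSpace (𝓡 n) p →L[ℝ] ℝ) p (g p))
  symm : ∀ (p : N) (u v : TangentSpace (𝓡 n) p), g p u v = g p v u
  nondegenerate : ∀ (p : N) (u : TangentSpace (𝓡 n) p), (∀ v, g p u v = 0) → u = 0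
  index_eq : ∀ p : N,
    sigNeg (LinearMap.BilinMap.toQuadraticMap (g p).toBilinForm) = q

/-- `cov` is the Levi-Civita connection of `g`: torsion-free and metric.
In Mathlib's convention `cov Y p u` is `∇_u Y` at `p`. -/
def IsLeviCivita {n : ℕ} {N : Type*} [TopologicalSpace N]
    [ChartedSpace (EuclideanSpace ℝ (Fin n)) N] [IsManifold (𝓡 n) ∞ N]
    (g : ∀ p : N, TangentSpace (𝓡 n) p →L[ℝ] TangentSpace (𝓡 n) p →L[ℝ] ℝ)
    (cov : CovariantDerivative (𝓡 n) (EuclideanSpace ℝ (Fin n))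
      (TangentSpace (𝓡 n) : N → Type _)) : Prop :=
  (∀ (X Y : ∀ p : N, TangentSpace (𝓡 n) p) (p : N),
    MDifferentiableAt (𝓡 n) (𝓡 n).tangent (fun y ↦ (⟨y, X y⟩ : TangentBundle (𝓡 n) N)) p →
    MDifferentiableAt (𝓡 n) (𝓡 n).tangent (fun y ↦ (⟨y, Y y⟩ : TangentBundle (𝓡 n) N)) p →
      cov Y p (X p) - cov X p (Y p) = VectorField.mlieBracket (𝓡 n) X Y p) ∧
  (∀ (Y Z : ∀ p : N, TangentSpace (𝓡 n) p) (p : N) (u : TangentSpace (𝓡 n) p),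
    MDifferentiableAt (𝓡 n) (𝓡 n).tangent (fun y ↦ (⟨y, Y y⟩ : TangentBundle (𝓡 n) N)) p →
    MDifferentiableAt (𝓡 n) (𝓡 n).tangent (fun y ↦ (⟨y, Z y⟩ : TangentBundle (𝓡 n) N)) p →
      mvfderiv (𝓡 n) (fun y ↦ g y (Y y) (Z y)) p u =
        g p (cov Y p u) (Z p) + g p (Y p) (cov Z p u))

/-- An indefinite Kähler structure on a `2k`-dimensional manifold: a semi-Riemannian metric `g` of
constant index `q`, `0 < q < 2k`, with a smooth almost complex structure `J` which is
`g`-orthogonal and parallel for the Levi-Civita connection of `g`. -/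
structure IndefiniteKaehlerStructure (k : ℕ) (N : Type*) [TopologicalSpace N]
    [ChartedSpace (EuclideanSpace ℝ (Fin (2 * k))) N] [IsManifold (𝓡 (2 * k)) ∞ N] where
  /-- the metric -/
  g : ∀ p : N, TangentSpace (𝓡 (2 * k)) p →L[ℝ] TangentSpace (𝓡 (2 * k)) p →L[ℝ] ℝ
  /-- the almost complex structure -/
  J : ∀ p : N, TangentSpace (𝓡 (2 * k)) p →L[ℝ] TangentSpace (𝓡 (2 * k)) p
  /-- the index -/
  q : ℕ
  q_pos : 0 < q
  q_lt : q < 2 * k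
  metric : IsSemiRiemannianMetric (2 * k) q g
  J_smooth : ContMDiff (𝓡 (2 * k)) ((𝓡 (2 * k)).prod
      𝓘(ℝ, EuclideanSpace ℝ (Fin (2 * k)) →L[ℝ] EuclideanSpace ℝ (Fin (2 * k)))) ∞
    (fun p ↦ TotalSpace.mk'
      (EuclideanSpace ℝ (Fin (2 * k)) →L[ℝ] EuclideanSpace ℝ (Fin (2 * k)))
      (E := fun p : N ↦ TangentSpace (𝓡 (2 * k)) p →L[ℝ] TangentSpace (𝓡 (2 * k)) p) p (J p))
  J_sq : ∀ (p : N) (u : TangentSpace (𝓡 (2 * k)) p), J p (J p u) = -u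
  hermitian : ∀ (p : N) (u v : TangentSpace (𝓡 (2 * k)) p), g p (J p u) (J p v) = g p u v
  parallel : ∃ cov : CovariantDerivative (𝓡 (2 * k)) (EuclideanSpace ℝ (Fin (2 * k)))
      (TangentSpace (𝓡 (2 * k)) : N → Type _), IsLeviCivita g cov ∧
    ∀ (Y : ∀ p : N, TangentSpace (𝓡 (2 * k)) p) (p : N) (u : TangentSpace (𝓡 (2 * k)) p),
      MDifferentiableAt (𝓡 (2 * k)) (𝓡 (2 * k)).tangent
        (fun y ↦ (⟨y, Y y⟩ : TangentBundle (𝓡 (2 * k)) N)) p →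
      cov (fun y ↦ J y (Y y)) p u = J p (cov Y p u)

end Ambient

section Subbundles

/-! A vector bundle over `M` occurring below is a subbundle of the restriction to `M` of the
tangent bundle of the ambient manifold, that is, a family of subspaces `V x` of `T_{f x} N`. -/

/-- `s` is a smooth frame of the family `V` over `U`. -/
def IsFrameOn (m : ℕ) {n : ℕ} {M N : Type*}
    [TopologicalSpace M] [ChartedSpace (EuclideanSpace ℝ (Fin m)) M]
    [TopologicalSpace N] [ChartedSpace (EuclideanSpace ℝ (Fin n)) N] [IsManifold (𝓡 n) ∞ N]
    (f : M → N) (V : ∀ x : M, Submodule ℝ (TangentSpace (𝓡 n) (f x))) {d : ℕ}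
    (s : Fin d → ∀ x : M, TangentSpace (𝓡 n) (f x)) (U : Set M) : Prop :=
  (∀ i, ContMDiffOn (𝓡 m) (𝓡 n).tangent ∞
    (fun x ↦ (⟨f x, s i x⟩ : TangentBundle (𝓡 n) N)) U) ∧
  ∀ x ∈ U, LinearIndependent ℝ (fun i ↦ s i x) ∧
    Submodule.span ℝ (Set.range fun i ↦ s i x) = V x

/-- `V` is a smooth subbundle of rank `d` of the restriction of `TN` to `M`. -/
def IsSubbundleOfRank (m : ℕ) {n : ℕ} {M N : Type*}
    [TopologicalSpace M] [ChartedSpace (EuclideanSpace ℝ (Fin m)) M]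
    [TopologicalSpace N] [ChartedSpace (EuclideanSpace ℝ (Fin n)) N] [IsManifold (𝓡 n) ∞ N]
    (f : M → N) (V : ∀ x : M, Submodule ℝ (TangentSpace (𝓡 n) (f x))) (d : ℕ) : Prop :=
  ∀ x₀ : M, ∃ U : Set M, IsOpen U ∧ x₀ ∈ U ∧
    ∃ s : Fin d → ∀ x : M, TangentSpace (𝓡 n) (f x), IsFrameOn m f V s U

/-- `V` is a smooth subbundle (of some constant rank) of the restriction of `TN` to `M`. -/
def IsSubbundle (m : ℕ) {n : ℕ} {M N : Type*}
    [TopologicalSpace M] [ChartedSpace (EuclideanSpace ℝ (Fin m)) M]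
    [TopologicalSpace N] [ChartedSpace (EuclideanSpace ℝ (Fin n)) N] [IsManifold (𝓡 n) ∞ N]
    (f : M → N) (V : ∀ x : M, Submodule ℝ (TangentSpace (𝓡 n) (f x))) : Prop :=
  ∃ d : ℕ, IsSubbundleOfRank m f V d

/-- `TM`, as a family of subspaces of `TN` along `f`. -/
noncomputable def tangent (m : ℕ) {n : ℕ} {M N : Type*}
    [TopologicalSpace M] [ChartedSpace (EuclideanSpace ℝ (Fin m)) M]
    [TopologicalSpace N] [ChartedSpace (EuclideanSpace ℝ (Fin n)) N]
    (f : M → N) (x : M) : Submodule ℝ (TangentSpace (𝓡 n) (f x)) :=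
  LinearMap.range (mfderiv (𝓡 m) (𝓡 n) f x).toLinearMap

/-- The orthogonal complement of a subspace of `T_p N` for the metric `g`. -/
def orth {n : ℕ} {N : Type*} [TopologicalSpace N] [ChartedSpace (EuclideanSpace ℝ (Fin n)) N]
    (g : ∀ p : N, TangentSpace (𝓡 n) p →L[ℝ] TangentSpace (𝓡 n) p →L[ℝ] ℝ) {p : N}
    (V : Submodule ℝ (TangentSpace (𝓡 n) p)) : Submodule ℝ (TangentSpace (𝓡 n) p) where
  carrier := {u | ∀ v ∈ V, g p u v = 0}
  zero_mem' := by intro v _; simp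
  add_mem' := by intro a b ha hb v hv; simp [ha v hv, hb v hv]
  smul_mem' := by intro c a ha v hv; simp [ha v hv]

/-- The normal bundle `TM^⊥`. -/
noncomputable def normal (m : ℕ) {n : ℕ} {M N : Type*}
    [TopologicalSpace M] [ChartedSpace (EuclideanSpace ℝ (Fin m)) M]
    [TopologicalSpace N] [ChartedSpace (EuclideanSpace ℝ (Fin n)) N]
    (g : ∀ p : N, TangentSpace (𝓡 n) p →L[ℝ] TangentSpace (𝓡 n) p →L[ℝ] ℝ)
    (f : M → N) (x : M) : Submodule ℝ (TangentSpace (𝓡 n) (f x)) :=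
  orth g (tangent m f x)

/-- The radical distribution `Rad(TM) = TM ∩ TM^⊥`. -/
noncomputable def rad (m : ℕ) {n : ℕ} {M N : Type*}
    [TopologicalSpace M] [ChartedSpace (EuclideanSpace ℝ (Fin m)) M]
    [TopologicalSpace N] [ChartedSpace (EuclideanSpace ℝ (Fin n)) N]
    (g : ∀ p : N, TangentSpace (𝓡 n) p →L[ℝ] TangentSpace (𝓡 n) p →L[ℝ] ℝ)
    (f : M → N) (x : M) : Submodule ℝ (TangentSpace (𝓡 n) (f x)) :=
  tangent m f x ⊓ normal m g f x

/-- `V = A ⊕ B`, a direct sum of subspaces. -/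
def IsDirectSum {E : Type*} [AddCommGroup E] [Module ℝ E] (V A B : Submodule ℝ E) : Prop :=
  A ⊓ B = ⊥ ∧ A ⊔ B = V

/-- `V = A ⊥ B`, an orthogonal direct sum of subspaces of `T_p N`. -/
def IsOrthSum {n : ℕ} {N : Type*} [TopologicalSpace N] [ChartedSpace (EuclideanSpace ℝ (Fin n)) N]
    (g : ∀ p : N, TangentSpace (𝓡 n) p →L[ℝ] TangentSpace (𝓡 n) p →L[ℝ] ℝ) {p : N}
    (V A B : Submodule ℝ (TangentSpace (𝓡 n) p)) : Prop :=
  IsDirectSum V A B ∧ ∀ a ∈ A, ∀ b ∈ B, g p a b = 0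

/-- The restriction of the metric to `V` is non-degenerate. -/
def IsNondegenerateOn {n : ℕ} {N : Type*} [TopologicalSpace N]
    [ChartedSpace (EuclideanSpace ℝ (Fin n)) N]
    (g : ∀ p : N, TangentSpace (𝓡 n) p →L[ℝ] TangentSpace (𝓡 n) p →L[ℝ] ℝ) {p : N}
    (V : Submodule ℝ (TangentSpace (𝓡 n) p)) : Prop :=
  V ⊓ orth g V = ⊥

end Subbundles

section Lightlike

/-- `f : M → N` is an `m`-dimensional lightlike submanifold of `(N, g)` whose radical distribution
is a smooth distribution of rank `r`, `1 ≤ r ≤ m`. -/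
structure IsLightlikeSubmanifold (m : ℕ) {n : ℕ} {M N : Type*}
    [TopologicalSpace M] [ChartedSpace (EuclideanSpace ℝ (Fin m)) M]
    [TopologicalSpace N] [ChartedSpace (EuclideanSpace ℝ (Fin n)) N] [IsManifold (𝓡 n) ∞ N]
    (g : ∀ p : N, TangentSpace (𝓡 n) p →L[ℝ] TangentSpace (𝓡 n) p →L[ℝ] ℝ)
    (f : M → N) (r : ℕ) : Prop where
  immersion : Manifold.IsImmersion (𝓡 m) (𝓡 n) ∞ f
  one_le : 1 ≤ r
  le_dim : r ≤ m
  rad_rank : IsSubbundleOfRank m f (rad m g f) r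

/-- `S` is a screen distribution `S(TM)`: a non-degenerate distribution with
`TM = S(TM) ⊥ Rad(TM)`. -/
structure IsScreen (m : ℕ) {n : ℕ} {M N : Type*}
    [TopologicalSpace M] [ChartedSpace (EuclideanSpace ℝ (Fin m)) M]
    [TopologicalSpace N] [ChartedSpace (EuclideanSpace ℝ (Fin n)) N] [IsManifold (𝓡 n) ∞ N]
    (g : ∀ p : N, TangentSpace (𝓡 n) p →L[ℝ] TangentSpace (𝓡 n) p →L[ℝ] ℝ)
    (f : M → N) (S : ∀ x : M, Submodule ℝ (TangentSpace (𝓡 n) (f x))) : Prop where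
  subbundle : IsSubbundle m f S
  nondegenerate : ∀ x, IsNondegenerateOn g (S x)
  orthSum : ∀ x, IsOrthSum g (tangent m f x) (S x) (rad m g f x)

/-- `St` is a screen transversal bundle `S(TM^⊥)`: a non-degenerate bundle with
`TM^⊥ = S(TM^⊥) ⊥ Rad(TM)`. -/
structure IsScreenTransversal (m : ℕ) {n : ℕ} {M N : Type*}
    [TopologicalSpace M] [ChartedSpace (EuclideanSpace ℝ (Fin m)) M]
    [TopologicalSpace N] [ChartedSpace (EuclideanSpace ℝ (Fin n)) N] [IsManifold (𝓡 n) ∞ N]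
    (g : ∀ p : N, TangentSpace (𝓡 n) p →L[ℝ] TangentSpace (𝓡 n) p →L[ℝ] ℝ)
    (f : M → N) (St : ∀ x : M, Submodule ℝ (TangentSpace (𝓡 n) (f x))) : Prop where
  subbundle : IsSubbundle m f St
  nondegenerate : ∀ x, IsNondegenerateOn g (St x)
  orthSum : ∀ x, IsOrthSum g (normal m g f x) (St x) (rad m g f x)

/-- `L` is the lightlike transversal bundle `ltr(TM)` for the screens `S = S(TM)` and
`St = S(TM^⊥)`: a complement of `Rad(TM)` in the orthogonal complement of `S(TM^⊥)` in `S(TM)^⊥`,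
with local frames `N_i` such that `g(ξ_i, N_j) = δ_ij` and `g(N_i, N_j) = 0` for a local frame
`ξ_i` of `Rad(TM)`. -/
structure IsLightlikeTransversal (m : ℕ) {n : ℕ} {M N : Type*}
    [TopologicalSpace M] [ChartedSpace (EuclideanSpace ℝ (Fin m)) M]
    [TopologicalSpace N] [ChartedSpace (EuclideanSpace ℝ (Fin n)) N] [IsManifold (𝓡 n) ∞ N]
    (g : ∀ p : N, TangentSpace (𝓡 n) p →L[ℝ] TangentSpace (𝓡 n) p →L[ℝ] ℝ)
    (f : M → N) (r : ℕ) (S St L : ∀ x : M, Submodule ℝ (TangentSpace (𝓡 n) (f x))) : Prop where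
  directSum : ∀ x, IsDirectSum (orth g (S x) ⊓ orth g (St x)) (rad m g f x) (L x)
  frames : ∀ x₀ : M, ∃ U : Set M, IsOpen U ∧ x₀ ∈ U ∧
    ∃ ξ η : Fin r → ∀ x : M, TangentSpace (𝓡 n) (f x),
      IsFrameOn m f (rad m g f) ξ U ∧ IsFrameOn m f L η U ∧
      ∀ x ∈ U, ∀ i j, g (f x) (ξ i x) (η j x) = (if i = j then 1 else 0) ∧
        g (f x) (η i x) (η j x) = 0

/-- A choice of `S(TM)`, `S(TM^⊥)` and `ltr(TM)` for an `r`-lightlike submanifold. -/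
structure ScreenData (m : ℕ) {n : ℕ} {M N : Type*}
    [TopologicalSpace M] [ChartedSpace (EuclideanSpace ℝ (Fin m)) M]
    [TopologicalSpace N] [ChartedSpace (EuclideanSpace ℝ (Fin n)) N] [IsManifold (𝓡 n) ∞ N]
    (g : ∀ p : N, TangentSpace (𝓡 n) p →L[ℝ] TangentSpace (𝓡 n) p →L[ℝ] ℝ)
    (f : M → N) (r : ℕ) where
  /-- `S(TM)` -/
  S : ∀ x : M, Submodule ℝ (TangentSpace (𝓡 n) (f x))
  /-- `S(TM^⊥)` -/
  St : ∀ x : M, Submodule ℝ (TangentSpace (𝓡 n) (f x))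
  /-- `ltr(TM)` -/
  ltr : ∀ x : M, Submodule ℝ (TangentSpace (𝓡 n) (f x))
  isScreen : IsScreen m g f S
  isScreenTransversal : IsScreenTransversal m g f St
  isLightlikeTransversal : IsLightlikeTransversal m g f r S St ltr

end Lightlike

section Classes

variable {m k r : ℕ} {M N : Type*}
  [TopologicalSpace M] [ChartedSpace (EuclideanSpace ℝ (Fin m)) M]
  [TopologicalSpace N] [ChartedSpace (EuclideanSpace ℝ (Fin (2 * k))) N]
  [IsManifold (𝓡 (2 * k)) ∞ N]

/-- The subspace `J V` of `T_p N`, for a subspace `V` of `T_p N`. -/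
noncomputable def IndefiniteKaehlerStructure.mapJ (K : IndefiniteKaehlerStructure k N) {p : N}
    (V : Submodule ℝ (TangentSpace (𝓡 (2 * k)) p)) : Submodule ℝ (TangentSpace (𝓡 (2 * k)) p) :=
  V.map (K.J p).toLinearMap

/-- The bundles `D₁, D₂, D₀, D', L₁, S₁` exhibiting `M`, with the given `S(TM)`, `S(TM^⊥)` and
`ltr(TM)`, as a screen transversal Cauchy-Riemann (STCR) lightlike submanifold:
`Rad(TM) = D₁ ⊕ D₂`, `J D₁ ⊆ S(TM)`, `J D₂ ⊆ S(TM^⊥)`,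
`S(TM) = {J D₁ ⊕ D'} ⊥ D₀`, `J D₀ = D₀`, `J D' = L₁ ⊥ S₁`, `L₁ ⊆ ltr(TM)`, `S₁ ⊆ S(TM^⊥)`,
with `D₀` non-degenerate. -/
structure STCRDecomposition (K : IndefiniteKaehlerStructure k N) (f : M → N)
    (d : ScreenData m K.g f r) where
  /-- the part of `Rad(TM)` mapped into `S(TM)` -/
  D₁ : ∀ x : M, Submodule ℝ (TangentSpace (𝓡 (2 * k)) (f x))
  /-- the part of `Rad(TM)` mapped into `S(TM^⊥)` -/
  D₂ : ∀ x : M, Submodule ℝ (TangentSpace (𝓡 (2 * k)) (f x))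
  /-- the invariant part of `S(TM)` -/
  D₀ : ∀ x : M, Submodule ℝ (TangentSpace (𝓡 (2 * k)) (f x))
  /-- the part of `S(TM)` mapped into the transversal bundle -/
  D' : ∀ x : M, Submodule ℝ (TangentSpace (𝓡 (2 * k)) (f x))
  /-- the lightlike transversal part of `J D'` -/
  L₁ : ∀ x : M, Submodule ℝ (TangentSpace (𝓡 (2 * k)) (f x))
  /-- the screen transversal part of `J D'` -/
  S₁ : ∀ x : M, Submodule ℝ (TangentSpace (𝓡 (2 * k)) (f x))
  D₁_subbundle : IsSubbundle m f D₁
  D₂_subbundle : IsSubbundle m f D₂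
  D₀_subbundle : IsSubbundle m f D₀
  D'_subbundle : IsSubbundle m f D'
  L₁_subbundle : IsSubbundle m f L₁
  S₁_subbundle : IsSubbundle m f S₁
  rad_eq : ∀ x, IsDirectSum (rad m K.g f x) (D₁ x) (D₂ x)
  J_D₁ : ∀ x, K.mapJ (D₁ x) ≤ d.S x
  J_D₂ : ∀ x, K.mapJ (D₂ x) ≤ d.St x
  D₀_nondegenerate : ∀ x, IsNondegenerateOn K.g (D₀ x)
  J_D₁_D' : ∀ x, K.mapJ (D₁ x) ⊓ D' x = ⊥
  screen_eq : ∀ x, IsOrthSum K.g (d.S x) (K.mapJ (D₁ x) ⊔ D' x) (D₀ x)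
  J_D₀ : ∀ x, K.mapJ (D₀ x) = D₀ x
  L₁_le : ∀ x, L₁ x ≤ d.ltr x
  S₁_le : ∀ x, S₁ x ≤ d.St x
  J_D' : ∀ x, IsOrthSum K.g (K.mapJ (D' x)) (L₁ x) (S₁ x)

/-- `M`, with the given `S(TM)`, `S(TM^⊥)` and `ltr(TM)`, is a CR-lightlike submanifold:
(A) `J Rad(TM)` is a distribution on `M` with `Rad(TM) ∩ J Rad(TM) = 0`;
(B) there are bundles `D₀`, `D'` on `M` with `S(TM) = {J Rad(TM) ⊕ D'} ⊥ D₀`, `J D₀ = D₀` and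
`J D' = L₁ ⊥ L₂`, where `D₀` is non-degenerate and `L₁`, `L₂` are subbundles of `ltr(TM)` and
`S(TM^⊥)`. -/
def IsCRLightlikeWith (K : IndefiniteKaehlerStructure k N) (f : M → N)
    (d : ScreenData m K.g f r) : Prop :=
  (IsSubbundle m f (fun x ↦ K.mapJ (rad m K.g f x)) ∧
    (∀ x, K.mapJ (rad m K.g f x) ≤ tangent m f x) ∧
    (∀ x, rad m K.g f x ⊓ K.mapJ (rad m K.g f x) = ⊥)) ∧
  ∃ D₀ D' L₁ L₂ : ∀ x : M, Submodule ℝ (TangentSpace (𝓡 (2 * k)) (f x)),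
    IsSubbundle m f D₀ ∧ IsSubbundle m f D' ∧ IsSubbundle m f L₁ ∧ IsSubbundle m f L₂ ∧
    (∀ x, IsNondegenerateOn K.g (D₀ x)) ∧
    (∀ x, K.mapJ (rad m K.g f x) ⊓ D' x = ⊥) ∧
    (∀ x, IsOrthSum K.g (d.S x) (K.mapJ (rad m K.g f x) ⊔ D' x) (D₀ x)) ∧
    (∀ x, K.mapJ (D₀ x) = D₀ x) ∧
    (∀ x, L₁ x ≤ d.ltr x) ∧ (∀ x, L₂ x ≤ d.St x) ∧
    (∀ x, IsOrthSum K.g (K.mapJ (D' x)) (L₁ x) (L₂ x))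

/-- `M` is a CR-lightlike submanifold: it is one for some choice of `S(TM)`, `S(TM^⊥)` and
`ltr(TM)`. -/
def IsCRLightlike (m : ℕ) {k : ℕ} {M N : Type*}
    [TopologicalSpace M] [ChartedSpace (EuclideanSpace ℝ (Fin m)) M]
    [TopologicalSpace N] [ChartedSpace (EuclideanSpace ℝ (Fin (2 * k))) N]
    [IsManifold (𝓡 (2 * k)) ∞ N]
    (K : IndefiniteKaehlerStructure k N) (f : M → N) (r : ℕ) : Prop :=
  ∃ d : ScreenData m K.g f r, IsCRLightlikeWith K f d

/-- `M`, with the given screen transversal bundle `S(TM^⊥)`, is a screen transversal lightlike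
submanifold: `J Rad(TM) ⊆ S(TM^⊥)`. -/
def IsSTLightlikeWith (K : IndefiniteKaehlerStructure k N) (f : M → N)
    (d : ScreenData m K.g f r) : Prop :=
  ∀ x, K.mapJ (rad m K.g f x) ≤ d.St x

/-- `M` is a screen transversal lightlike submanifold: there is a screen transversal bundle
`S(TM^⊥)` with `J Rad(TM) ⊆ S(TM^⊥)`. -/
def IsSTLightlike (m : ℕ) {k : ℕ} {M N : Type*}
    [TopologicalSpace M] [ChartedSpace (EuclideanSpace ℝ (Fin m)) M]
    [TopologicalSpace N] [ChartedSpace (EuclideanSpace ℝ (Fin (2 * k))) N]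
    [IsManifold (𝓡 (2 * k)) ∞ N]
    (K : IndefiniteKaehlerStructure k N) (f : M → N) : Prop :=
  ∃ St : ∀ x : M, Submodule ℝ (TangentSpace (𝓡 (2 * k)) (f x)),
    IsScreenTransversal m K.g f St ∧ ∀ x, K.mapJ (rad m K.g f x) ≤ St x

end Classes

end LightlikeGeometry

namespace LightlikeGeometry

/-! ### Linear algebra of direct and orthogonal sums at a point -/

section Pointwise

variable {n : ℕ} {N : Type*} [TopologicalSpace N] [ChartedSpace (EuclideanSpace ℝ (Fin n)) N]
  {g : ∀ p : N, TangentSpace (𝓡 n) p →L[ℝ] TangentSpace (𝓡 n) p →L[ℝ] ℝ}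

/-! Two intersections vanish for every choice of screens: `S(TM) ∩ TM^⊥ = 0` and `S(TM^⊥) ∩ TM = 0`,
since each lies both in a screen and in `Rad(TM)`. Being CR-lightlike for any screens gives `J
Rad(TM) ⊆ TM`, and being screen transversal for any `S(TM^⊥)` gives `J Rad(TM) ⊆ TM^⊥`. Neither
inclusion mentions screens, which is why the choice does not matter. The first puts `J D₂` in
`S(TM^⊥) ∩ TM`, the second puts `J D₁` in `S(TM) ∩ TM^⊥`; as `J` is injective, `D₂ = 0` or `D₁ = 0`
respectively. Conversely, if one summand is zero then `Rad(TM)` is the other, and the required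
conditions can be read off the decomposition.

The one further point is the criterion in the screen transversal case: there `L₁ = 0`. For `v` in
`D'` and `ξ` radical, `g(ξ, Jv) = -g(Jξ, v) = 0`, because `Jξ` is normal and `v` tangent, while no
nonzero vector of `ltr(TM)` is orthogonal to `Rad(TM)`. Hence `J D' = S₁ ⊆ S(TM^⊥)`. -/

theorem IsDirectSum.left_le {E : Type*} [AddCommGroup E] [Module ℝ E] {V A B : Submodule ℝ E}
    (h : IsDirectSum V A B) : A ≤ V :=
  h.2 ▸ le_sup_left

theorem IsDirectSum.right_le {E : Type*} [AddCommGroup E] [Module ℝ E] {V A B : Submodule ℝ E}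
    (h : IsDirectSum V A B) : B ≤ V :=
  h.2 ▸ le_sup_right

theorem IsDirectSum.eq_left {E : Type*} [AddCommGroup E] [Module ℝ E] {V A B : Submodule ℝ E}
    (h : IsDirectSum V A B) (hB : B = ⊥) : V = A := by
  rw [← h.2, hB, sup_bot_eq]

theorem IsDirectSum.eq_right {E : Type*} [AddCommGroup E] [Module ℝ E] {V A B : Submodule ℝ E}
    (h : IsDirectSum V A B) (hA : A = ⊥) : V = B := by
  rw [← h.2, hA, bot_sup_eq]

theorem isDirectSum_bot_right {E : Type*} [AddCommGroup E] [Module ℝ E] (V : Submodule ℝ E) :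
    IsDirectSum V V ⊥ :=
  ⟨inf_bot_eq V, sup_bot_eq V⟩

theorem isDirectSum_bot_left {E : Type*} [AddCommGroup E] [Module ℝ E] (V : Submodule ℝ E) :
    IsDirectSum V ⊥ V :=
  ⟨bot_inf_eq V, bot_sup_eq V⟩

theorem isOrthSum_bot_left {p : N} (V : Submodule ℝ (TangentSpace (𝓡 n) p)) :
    IsOrthSum g V ⊥ V := by
  refine ⟨isDirectSum_bot_left V, fun a ha b _ ↦ ?_⟩
  rw [(Submodule.mem_bot ℝ).1 ha]
  simp

end Pointwise

/-! ### Intersections of the screens with `TM` and `TM^⊥`, and the duality of `Rad(TM)` and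
`ltr(TM)` -/

section Screens

variable {m n r : ℕ} {M N : Type*}
  [TopologicalSpace M] [ChartedSpace (EuclideanSpace ℝ (Fin m)) M]
  [TopologicalSpace N] [ChartedSpace (EuclideanSpace ℝ (Fin n)) N] [IsManifold (𝓡 n) ∞ N]
  {g : ∀ p : N, TangentSpace (𝓡 n) p →L[ℝ] TangentSpace (𝓡 n) p →L[ℝ] ℝ} {f : M → N}

theorem isSubbundle_bot : IsSubbundle m f
    (fun x ↦ (⊥ : Submodule ℝ (TangentSpace (𝓡 n) (f x)))) := by
  -- The empty family is a frame of the zero bundle over all of `M`.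
  refine ⟨0, fun x₀ ↦ ⟨Set.univ, isOpen_univ, Set.mem_univ x₀, fun i ↦ i.elim0,
    fun i ↦ i.elim0, fun x _ ↦ ⟨linearIndependent_empty_type, ?_⟩⟩⟩
  simp

theorem IsScreen.le_tangent {S : ∀ x : M, Submodule ℝ (TangentSpace (𝓡 n) (f x))}
    (h : IsScreen m g f S) (x : M) : S x ≤ tangent m f x :=
  (h.orthSum x).1.left_le

theorem IsScreenTransversal.le_normal {St : ∀ x : M, Submodule ℝ (TangentSpace (𝓡 n) (f x))}
    (h : IsScreenTransversal m g f St) (x : M) : St x ≤ normal m g f x :=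
  (h.orthSum x).1.left_le

/-- Since `S(TM) ⊆ TM`, a normal vector in it is radical, and `S(TM)` meets `Rad(TM)` only in zero.
-/
theorem IsScreen.inf_normal {S : ∀ x : M, Submodule ℝ (TangentSpace (𝓡 n) (f x))}
    (h : IsScreen m g f S) (x : M) : S x ⊓ normal m g f x = ⊥ := by
  rw [eq_bot_iff, ← (h.orthSum x).1.1]
  exact le_inf inf_le_left (inf_le_inf_right _ (h.le_tangent x))

theorem IsScreenTransversal.inf_tangent {St : ∀ x : M, Submodule ℝ (TangentSpace (𝓡 n) (f x))}
    (h : IsScreenTransversal m g f St) (x : M) : St x ⊓ tangent m f x = ⊥ := by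
  rw [eq_bot_iff, ← (h.orthSum x).1.1]
  exact le_inf inf_le_left (le_inf inf_le_right (inf_le_left.trans (h.le_normal x)))

/-- The pairing of `Rad(TM)` with `ltr(TM)` is non-degenerate on `ltr(TM)`. -/
theorem IsLightlikeTransversal.eq_zero_of_orthogonal
    {S St L : ∀ x : M, Submodule ℝ (TangentSpace (𝓡 n) (f x))}
    (h : IsLightlikeTransversal m g f r S St L) {x : M} {u : TangentSpace (𝓡 n) (f x)}
    (hu : u ∈ L x) (h0 : ∀ ξ ∈ rad m g f x, g (f x) ξ u = 0) : u = 0 := by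
  obtain ⟨U, -, hxU, ξ, η, hξ, hη, hp⟩ := h.frames x
  rw [← (hη.2 x hxU).2, Submodule.mem_span_range_iff_exists_fun] at hu
  obtain ⟨c, rfl⟩ := hu
  refine Finset.sum_eq_zero fun j _ ↦ ?_
  have hξj : ξ j x ∈ rad m g f x := by
    rw [← (hξ.2 x hxU).2]
    exact Submodule.subset_span ⟨j, rfl⟩
  -- The frames are dual, so pairing with `ξ j` extracts the coefficient `c j`.
  have hc : c j = 0 := by
    simpa [map_sum, (hp x hxU _ _).1] using h0 _ hξj
  rw [hc, zero_smul]

end Screens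

/-! ### Action of `J` on subspaces and subbundles -/

section Kaehler

variable {m k r : ℕ} {M N : Type*}
  [TopologicalSpace M] [ChartedSpace (EuclideanSpace ℝ (Fin m)) M]
  [TopologicalSpace N] [ChartedSpace (EuclideanSpace ℝ (Fin (2 * k))) N]
  [IsManifold (𝓡 (2 * k)) ∞ N]
  {K : IndefiniteKaehlerStructure k N} {f : M → N}

namespace IndefiniteKaehlerStructure

theorem J_injective (K : IndefiniteKaehlerStructure k N) (p : N) :
    Function.Injective (K.J p) := fun u v h ↦ by
  have := congrArg (K.J p) h
  rwa [K.J_sq, K.J_sq, neg_inj] at this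

/-- An orthogonal `J` with `J² = -1` is skew-adjoint; this lets `J` be moved from `D'` onto
`Rad(TM)`. -/
theorem g_J_left (K : IndefiniteKaehlerStructure k N) (p : N)
    (u v : TangentSpace (𝓡 (2 * k)) p) : K.g p (K.J p u) v = -K.g p u (K.J p v) := by
  rw [← K.hermitian p u (K.J p v), K.J_sq, map_neg, neg_neg]

theorem mapJ_bot (K : IndefiniteKaehlerStructure k N) (p : N) :
    K.mapJ (⊥ : Submodule ℝ (TangentSpace (𝓡 (2 * k)) p)) = ⊥ :=
  Submodule.map_bot _

theorem mapJ_eq_bot {p : N} {V : Submodule ℝ (TangentSpace (𝓡 (2 * k)) p)}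
    (h : K.mapJ V = ⊥) : V = ⊥ :=
  (Submodule.eq_bot_iff V).2 fun _ hv ↦ K.J_injective p
    (((Submodule.eq_bot_iff _).1 h _ (Submodule.mem_map_of_mem hv)).trans (map_zero _).symm)

theorem mapJ_mono {p : N} {V W : Submodule ℝ (TangentSpace (𝓡 (2 * k)) p)} (h : V ≤ W) :
    K.mapJ V ≤ K.mapJ W :=
  Submodule.map_mono h

end IndefiniteKaehlerStructure

/-- `J` maps subbundles to subbundles. -/
theorem IsSubbundle.mapJ (K : IndefiniteKaehlerStructure k N)
    (hf : ContMDiff (𝓡 m) (𝓡 (2 * k)) ∞ f)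
    {V : ∀ x : M, Submodule ℝ (TangentSpace (𝓡 (2 * k)) (f x))} (hV : IsSubbundle m f V) :
    IsSubbundle m f (fun x ↦ K.mapJ (V x)) := by
  obtain ⟨d, hd⟩ := hV
  refine ⟨d, fun x₀ ↦ ?_⟩
  obtain ⟨U, hU, hx, s, hs, hs'⟩ := hd x₀
  refine ⟨U, hU, hx, fun i x ↦ K.J (f x) (s i x), fun i ↦ ?_, fun x hxU ↦ ⟨?_, ?_⟩⟩
  -- Smoothness of `f` enters here: it makes `J` along `f` a smooth field of endomorphisms.
  · exact ContMDiffOn.clm_bundle_apply (IB := 𝓡 (2 * k))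
      (F₁ := EuclideanSpace ℝ (Fin (2 * k))) (F₂ := EuclideanSpace ℝ (Fin (2 * k)))
      (E₁ := fun p : N ↦ TangentSpace (𝓡 (2 * k)) p)
      (E₂ := fun p : N ↦ TangentSpace (𝓡 (2 * k)) p)
      (b := f) (ϕ := fun x ↦ K.J (f x)) (v := fun x ↦ s i x)
      ((K.J_smooth.comp hf).contMDiffOn) (hs i)
  · exact (hs' x hxU).1.map' (K.J (f x)).toLinearMap (LinearMap.ker_eq_bot.2 (K.J_injective _))
  · beta_reduce
    rw [← (hs' x hxU).2, IndefiniteKaehlerStructure.mapJ, Submodule.map_span, ← Set.range_comp]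
    rfl

/-! ### Vanishing of the summands of an STCR decomposition -/

namespace STCRDecomposition

variable {d : ScreenData m K.g f r}

theorem D₁_le_rad (e : STCRDecomposition K f d) (x : M) : e.D₁ x ≤ rad m K.g f x :=
  (e.rad_eq x).left_le

theorem D₂_le_rad (e : STCRDecomposition K f d) (x : M) : e.D₂ x ≤ rad m K.g f x :=
  (e.rad_eq x).right_le

/-- `J D₁` would lie in `S(TM) ∩ TM^⊥ = 0`. The hypothesis is free of screens, so it may come from a
choice other than `d`. -/
theorem D₁_eq_bot_of_mapJ_rad_le_normal (e : STCRDecomposition K f d) {x : M}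
    (h : K.mapJ (rad m K.g f x) ≤ normal m K.g f x) : e.D₁ x = ⊥ := by
  refine K.mapJ_eq_bot (eq_bot_iff.2 ?_)
  rw [← d.isScreen.inf_normal x]
  exact le_inf (e.J_D₁ x) ((K.mapJ_mono (e.D₁_le_rad x)).trans h)

theorem D₂_eq_bot_of_mapJ_rad_le_tangent (e : STCRDecomposition K f d) {x : M}
    (h : K.mapJ (rad m K.g f x) ≤ tangent m f x) : e.D₂ x = ⊥ := by
  refine K.mapJ_eq_bot (eq_bot_iff.2 ?_)
  rw [← d.isScreenTransversal.inf_tangent x]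
  exact le_inf (e.J_D₂ x) ((K.mapJ_mono (e.D₂_le_rad x)).trans h)

theorem isCRLightlikeWith (e : STCRDecomposition K f d)
    (hf : ContMDiff (𝓡 m) (𝓡 (2 * k)) ∞ f) (h : ∀ x, e.D₂ x = ⊥) :
    IsCRLightlikeWith K f d := by
  -- As an equality of families, this also transports the subbundle property and turns the STCR
  -- clauses into the CR ones.
  have hD : e.D₁ = rad m K.g f := funext fun x ↦ ((e.rad_eq x).eq_left (h x)).symm
  have hJ : ∀ x, K.mapJ (rad m K.g f x) ≤ d.S x := hD ▸ e.J_D₁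
  refine ⟨⟨IsSubbundle.mapJ K hf (hD ▸ e.D₁_subbundle),
    fun x ↦ (hJ x).trans (d.isScreen.le_tangent x), fun x ↦ eq_bot_iff.2 ?_⟩,
    e.D₀, e.D', e.L₁, e.S₁, e.D₀_subbundle, e.D'_subbundle, e.L₁_subbundle, e.S₁_subbundle,
    e.D₀_nondegenerate, hD ▸ e.J_D₁_D', hD ▸ e.screen_eq, e.J_D₀, e.L₁_le, e.S₁_le, e.J_D'⟩
  -- `Rad(TM) ∩ J Rad(TM) = 0` because `J Rad(TM)` lies in `S(TM)`, a complement of `Rad(TM)`.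
  rw [← (d.isScreen.orthSum x).1.1]
  exact le_inf (inf_le_right.trans (hJ x)) inf_le_left

theorem isSTLightlikeWith (e : STCRDecomposition K f d) (h : ∀ x, e.D₁ x = ⊥) :
    IsSTLightlikeWith K f d := fun x ↦ by
  rw [(e.rad_eq x).eq_right (h x)]
  exact e.J_D₂ x

theorem D'_le_screen (e : STCRDecomposition K f d) (x : M) : e.D' x ≤ d.S x :=
  le_sup_right.trans (e.screen_eq x).1.left_le

/-- If `J Rad(TM)` is normal, then `J D'` has no lightlike transversal part. -/
theorem L₁_eq_bot_of_mapJ_rad_le_normal (e : STCRDecomposition K f d) {x : M}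
    (h : K.mapJ (rad m K.g f x) ≤ normal m K.g f x) : e.L₁ x = ⊥ := by
  refine (Submodule.eq_bot_iff _).2 fun u hu ↦ ?_
  refine d.isLightlikeTransversal.eq_zero_of_orthogonal (e.L₁_le x hu) fun ξ hξ ↦ ?_
  obtain ⟨v, hv, rfl⟩ : u ∈ K.mapJ (e.D' x) := (e.J_D' x).1.left_le hu
  -- Here `u = Jv`; the vector `Jξ` is normal and `v` is tangent.
  have hJ : K.g (f x) (K.J (f x) ξ) v = 0 :=
    h (Submodule.mem_map_of_mem hξ) v (d.isScreen.le_tangent x (e.D'_le_screen x hv))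
  rw [K.g_J_left, neg_eq_zero] at hJ
  exact hJ

end STCRDecomposition

/-! ### Passing between the three classes -/

theorem IsCRLightlike.mapJ_rad_le_tangent (h : IsCRLightlike m K f r) (x : M) :
    K.mapJ (rad m K.g f x) ≤ tangent m f x :=
  h.elim fun _ hd ↦ hd.1.2.1 x

theorem IsSTLightlike.mapJ_rad_le_normal (h : IsSTLightlike m K f) (x : M) :
    K.mapJ (rad m K.g f x) ≤ normal m K.g f x :=
  h.elim fun _ hSt ↦ (hSt.2 x).trans (hSt.1.le_normal x)

theorem IsSTLightlikeWith.isSTLightlike {d : ScreenData m K.g f r}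
    (h : IsSTLightlikeWith K f d) : IsSTLightlike m K f :=
  ⟨d.St, d.isScreenTransversal, h⟩

theorem IsCRLightlikeWith.nonempty_stcrDecomposition {d : ScreenData m K.g f r}
    (hrad : IsSubbundle m f (rad m K.g f)) (h : IsCRLightlikeWith K f d) :
    Nonempty (STCRDecomposition K f d) := by
  obtain ⟨-, D₀, D', L₁, L₂, hD₀, hD', hL₁, hL₂, hnd, hinf, hS, hJ, hL₁le, hL₂le, hJD'⟩ := h
  exact ⟨{
    D₁ := rad m K.g f
    D₂ := fun _ ↦ ⊥
    D₀ := D₀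
    D' := D'
    L₁ := L₁
    S₁ := L₂
    D₁_subbundle := hrad
    D₂_subbundle := isSubbundle_bot
    D₀_subbundle := hD₀
    D'_subbundle := hD'
    L₁_subbundle := hL₁
    S₁_subbundle := hL₂
    rad_eq := fun x ↦ isDirectSum_bot_right _
    J_D₁ := fun x ↦ le_sup_left.trans (hS x).1.left_le
    J_D₂ := fun x ↦ (K.mapJ_bot (f x)).trans_le bot_le
    D₀_nondegenerate := hnd
    J_D₁_D' := hinf
    screen_eq := hS
    J_D₀ := hJ
    L₁_le := hL₁le
    S₁_le := hL₂le
    J_D' := hJD' }⟩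

theorem IsSTLightlikeWith.nonempty_stcrDecomposition_iff {d : ScreenData m K.g f r}
    (hf : ContMDiff (𝓡 m) (𝓡 (2 * k)) ∞ f) (hrad : IsSubbundle m f (rad m K.g f))
    (h : IsSTLightlikeWith K f d) :
    Nonempty (STCRDecomposition K f d) ↔
      ∃ D₀ D' : ∀ x : M, Submodule ℝ (TangentSpace (𝓡 (2 * k)) (f x)),
        IsSubbundle m f D₀ ∧ IsSubbundle m f D' ∧
        ∀ x, IsNondegenerateOn K.g (D₀ x) ∧ IsOrthSum K.g (d.S x) (D' x) (D₀ x) ∧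
          K.mapJ (D₀ x) = D₀ x ∧ K.mapJ (D' x) ≤ d.St x := by
  constructor
  · rintro ⟨e⟩
    refine ⟨e.D₀, e.D', e.D₀_subbundle, e.D'_subbundle, fun x ↦
      ⟨e.D₀_nondegenerate x, ?_, e.J_D₀ x, ?_⟩⟩
    · have hS := e.screen_eq x
      rwa [e.D₁_eq_bot_of_mapJ_rad_le_normal (h.isSTLightlike.mapJ_rad_le_normal x), K.mapJ_bot,
        bot_sup_eq] at hS
    · rw [(e.J_D' x).1.eq_right
        (e.L₁_eq_bot_of_mapJ_rad_le_normal (h.isSTLightlike.mapJ_rad_le_normal x))]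
      exact e.S₁_le x
  · rintro ⟨D₀, D', hD₀, hD', hx⟩
    exact ⟨{
      D₁ := fun _ ↦ ⊥
      D₂ := rad m K.g f
      D₀ := D₀
      D' := D'
      L₁ := fun _ ↦ ⊥
      -- With `L₁ = 0`, the condition `J D' = L₁ ⊥ S₁` leaves no other choice.
      S₁ := fun x ↦ K.mapJ (D' x)
      D₁_subbundle := isSubbundle_bot
      D₂_subbundle := hrad
      D₀_subbundle := hD₀
      D'_subbundle := hD'
      L₁_subbundle := isSubbundle_bot
      S₁_subbundle := hD'.mapJ K hf
      rad_eq := fun x ↦ isDirectSum_bot_left _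
      J_D₁ := fun x ↦ (K.mapJ_bot (f x)).trans_le bot_le
      J_D₂ := h
      D₀_nondegenerate := fun x ↦ (hx x).1
      J_D₁_D' := fun x ↦ by rw [K.mapJ_bot, bot_inf_eq]
      screen_eq := fun x ↦ by
        rw [K.mapJ_bot, bot_sup_eq]
        exact (hx x).2.1
      J_D₀ := fun x ↦ (hx x).2.2.1
      L₁_le := fun x ↦ bot_le
      S₁_le := fun x ↦ (hx x).2.2.2
      J_D' := fun x ↦ isOrthSum_bot_left _ }⟩

end Kaehler

end LightlikeGeometry

theorem proposition3p1 {k m r : ℕ} {M N : Type*}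
    [TopologicalSpace M] [ChartedSpace (EuclideanSpace ℝ (Fin m)) M] [IsManifold (𝓡 m) ∞ M]
    [TopologicalSpace N] [ChartedSpace (EuclideanSpace ℝ (Fin (2 * k))) N]
    [IsManifold (𝓡 (2 * k)) ∞ N]
    (K : LightlikeGeometry.IndefiniteKaehlerStructure k N) (f : M → N)
    (hf : LightlikeGeometry.IsLightlikeSubmanifold m K.g f r) :
    (∀ (d : LightlikeGeometry.ScreenData m K.g f r)
      (e : LightlikeGeometry.STCRDecomposition K f d),
      (LightlikeGeometry.IsCRLightlike m K f r ↔ ∀ x, e.D₂ x = ⊥) ∧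
      (LightlikeGeometry.IsCRLightlikeWith K f d ↔ ∀ x, e.D₂ x = ⊥) ∧
      (LightlikeGeometry.IsSTLightlike m K f ↔ ∀ x, e.D₁ x = ⊥) ∧
      (LightlikeGeometry.IsSTLightlikeWith K f d ↔ ∀ x, e.D₁ x = ⊥)) ∧
    (∀ d : LightlikeGeometry.ScreenData m K.g f r,
      LightlikeGeometry.IsCRLightlikeWith K f d →
        Nonempty (LightlikeGeometry.STCRDecomposition K f d)) ∧
    (∀ d : LightlikeGeometry.ScreenData m K.g f r,
      LightlikeGeometry.IsSTLightlikeWith K f d →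
        (Nonempty (LightlikeGeometry.STCRDecomposition K f d) ↔
          ∃ D₀ D' : ∀ x : M, Submodule ℝ (TangentSpace (𝓡 (2 * k)) (f x)),
            LightlikeGeometry.IsSubbundle m f D₀ ∧ LightlikeGeometry.IsSubbundle m f D' ∧
            ∀ x, LightlikeGeometry.IsNondegenerateOn K.g (D₀ x) ∧
              LightlikeGeometry.IsOrthSum K.g (d.S x) (D' x) (D₀ x) ∧
              K.mapJ (D₀ x) = D₀ x ∧ K.mapJ (D' x) ≤ d.St x)) := by
  have hsm := hf.immersion.contMDiff
  have hrad : LightlikeGeometry.IsSubbundle m f (LightlikeGeometry.rad m K.g f) :=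
    ⟨r, hf.rad_rank⟩
  refine ⟨fun d e ↦ ?_, fun d hd ↦ hd.nonempty_stcrDecomposition hrad,
    fun d hd ↦ hd.nonempty_stcrDecomposition_iff hsm hrad⟩
  -- The forward directions are proved for arbitrary screens, the converses for `d` itself; together
  -- they close all four equivalences.
  have hCR : LightlikeGeometry.IsCRLightlike m K f r → ∀ x, e.D₂ x = ⊥ :=
    fun h x ↦ e.D₂_eq_bot_of_mapJ_rad_le_tangent (h.mapJ_rad_le_tangent x)
  have hST : LightlikeGeometry.IsSTLightlike m K f → ∀ x, e.D₁ x = ⊥ :=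
    fun h x ↦ e.D₁_eq_bot_of_mapJ_rad_le_normal (h.mapJ_rad_le_normal x)
  exact ⟨⟨hCR, fun h ↦ ⟨d, e.isCRLightlikeWith hsm h⟩⟩,
    ⟨fun h ↦ hCR ⟨d, h⟩, e.isCRLightlikeWith hsm⟩,
    ⟨hST, fun h ↦ (e.isSTLightlikeWith h).isSTLightlike⟩,
    ⟨fun h ↦ hST h.isSTLightlike, e.isSTLightlikeWith⟩⟩
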